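/- **Setting.** For $K\ge 1$ let $\Theta_K$ be the set of pairs $\theta=(\pi,H)$ with $\pi_a>0$ for all $a\in[K]=\{1,\dots,K\}$, $\sum_{a=1}^K\pi_a=1$, and $H$ a symmetric $K\times K$ matrix with entries in $(0,1)$. Under the stochastic block model $\mathbb P_\theta$ on $n$ nodes, the latent labels $Z_1,\dots,Z_n\in[K]$ are i.i.d. with $\mathbb P(Z_i=a)=\pi_a$ and, given $Z$, the entries $A_{i,j}$, $i<j$, of the adjacency matrix are independent with $A_{i,j}\sim\mathrm{Bernoulli}(H_{Z_i,Z_j})$; moreover $A_{j,i}=A_{i,j}$ and $A_{i,i}=0$. For $\theta\in\Theta_{K'}$ the likelihood of $A$ is $g(A;\theta)=\sum_{z\in[K']^n}f(z,A;\theta)$, where $$f(z,A;\theta)=\Big(\prod_{a=1}^{K'}\pi_a^{n_a(z)}\Big)\Big(\prod_{a,b=1}^{K'}H_{a,b}^{O_{a,b}(z)}(1-H_{a,b})^{n_{a,b}(z)-O_{a,b}(z)}\Big)^{1/2},$$ $n_a(z)=\sum_i\mathbb I(z_i=a)$, $n_{a,b}(z)=\sum_i\sum_{j\ne i}\mathbb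 I(z_i=a,z_j=b)$, $O_{a,b}(z)=\sum_i\sum_{j\neq i}\mathbb I(z_i=a,z_j=b)A_{i,j}$. The graph on $n$ nodes is generated by $\theta^*=\theta^*_n=(\pi^*,\rho_nS^*)\in\Theta_K$, where $K$, $\pi^*$ and the symmetric matrix $S^*$ do not depend on $n$, $S^*$ has no two identical columns, $\rho_n>0$, and $n\rho_n/\log n\to\infty$. Let $(N_k)_{k\ge1}$ be a strictly increasing real sequence, $(B_n)$ a real sequence, and $$\beta(K')=\sup_{\theta\in\Theta_{K'}}\log g(A;\theta)-N_{K'}B_n .$$ **Statement.** 1. If $B_n=o(n^2\rho_n)$, then for every $1\le K'<K$, $\ \mathbb P_{\theta^*}(\beta(K')<\beta(K))\to1$ as $n\to\infty$. 2. If $B_nn^{-3/2}\rho_n^{-1/2}\to\infty$, then for every $K'>K$, $\ \mathbb P_{\theta^*}(\beta(K')<\beta(K))\to1$ as $n\to\infty$. 3. Consequently, if both conditions on $B_n$ hold, then for every fixed $K_{\max}\ge K$, with probability tending to one $K$ is the unique maximizer of $\beta(K')$ over $K'\in\{1,\dots,K_{\max}\}$. -/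

import Mathlib

open Filter Topology MeasureTheory

namespace SBM

/-- A parameter `θ = (π, H)` of a stochastic block model with `K` blocks: block proportions and
the matrix of connection probabilities. -/
structure Param (K : ℕ) where
  /-- the block proportions `π` -/
  prop : Fin K → ℝ
  /-- the connectivity matrix `H` -/
  conn : Matrix (Fin K) (Fin K) ℝ

/-- The parameter space `Θ_K`: positive block proportions summing to one, and a symmetric matrix
with entries in `(0, 1)`. For `K ≥ 2` the first two conditions give `π ∈ (0, 1) ^ K`; for `K = 1`
they give `π = 1` (the Erdős–Rényi model). -/
def Theta (K : ℕ) : Set (Param K) :=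
  {θ | (∀ a, 0 < θ.prop a) ∧ ∑ a, θ.prop a = 1 ∧ θ.conn.IsSymm ∧
    ∀ a b, θ.conn a b ∈ Set.Ioo (0 : ℝ) 1}

/-- The unordered pairs of distinct nodes, each listed once as `(i, j)` with `i < j`. -/
abbrev Pair (n : ℕ) : Type := {e : Fin n × Fin n // e.1 < e.2}

/-- The undirected graph on `n` nodes with edge indicators `y`. -/
def graphOf {n : ℕ} (y : Pair n → Bool) : SimpleGraph (Fin n) :=
  SimpleGraph.fromRel fun i j => ∃ h : i < j, y ⟨(i, j), h⟩ = true

/-- The Bernoulli distribution with success probability `p` (clamped to `[0, 1]`, which changes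
nothing for connection probabilities of a parameter in `Theta K`). -/
noncomputable def bernoulliLaw (p : ℝ) : Measure Bool :=
  ProbabilityTheory.bernoulliMeasure true false (Set.projIcc (0 : ℝ) 1 zero_le_one p)

/-- The distribution of one latent label: label `a` with probability `π_a`. -/
noncomputable def labelLaw {K : ℕ} (θ : Param K) : Measure (Fin K) :=
  ∑ a, ENNReal.ofReal (θ.prop a) • Measure.dirac a

/-- The distribution of the latent label vector `Z = (Z_1, …, Z_n)`: independent labels. -/
noncomputable def labelsLaw {K : ℕ} (n : ℕ) (θ : Param K) : Measure (Fin n → Fin K) :=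
  Measure.pi fun _ => labelLaw θ

/-- The conditional distribution of the graph given the labels `Z = z`: the edges are independent,
and `{i, j}` is present with probability `H_{z_i, z_j}`. -/
noncomputable def condLaw {n K : ℕ} (θ : Param K) (z : Fin n → Fin K) :
    Measure (SimpleGraph (Fin n)) :=
  (Measure.pi fun e : Pair n => bernoulliLaw (θ.conn (z e.1.1) (z e.1.2))).map graphOf

/-- The distribution `ℙ_θ` of the observed graph on `n` nodes under the stochastic block model
with parameter `θ`. -/
noncomputable def law {K : ℕ} (n : ℕ) (θ : Param K) : Measure (SimpleGraph (Fin n)) :=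
  (labelsLaw n θ).bind (condLaw θ)

section Likelihood

variable {n K : ℕ}

/-- `n_a(z)`, the number of nodes labelled `a`. -/
def nodeCount (z : Fin n → Fin K) (a : Fin K) : ℕ :=
  ∑ i, if z i = a then 1 else 0

/-- `n_{a,b}(z)`, the number of ordered pairs of distinct nodes labelled `a` and `b`. -/
def pairCount (z : Fin n → Fin K) (a b : Fin K) : ℕ :=
  ∑ i, ∑ j, if j ≠ i ∧ z i = a ∧ z j = b then 1 else 0

open Classical in
/-- `O_{a,b}(z)`, the sum of the entries `A_{i,j}` of the adjacency matrix over the ordered pairs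
of distinct nodes labelled `a` and `b`. -/
noncomputable def edgeCount (G : SimpleGraph (Fin n)) (z : Fin n → Fin K) (a b : Fin K) : ℕ :=
  ∑ i, ∑ j, if j ≠ i ∧ z i = a ∧ z j = b then G.adjMatrix ℕ i j else 0

/-- The complete likelihood `f(z, A; θ)`. -/
noncomputable def completeLikelihood (z : Fin n → Fin K) (G : SimpleGraph (Fin n))
    (θ : Param K) : ℝ :=
  (∏ a, θ.prop a ^ nodeCount z a) *
    Real.sqrt (∏ a, ∏ b, θ.conn a b ^ edgeCount G z a b *
      (1 - θ.conn a b) ^ (pairCount z a b - edgeCount G z a b))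

/-- The likelihood `g(A; θ)`, the sum of the complete likelihood over all label vectors. -/
noncomputable def likelihood (G : SimpleGraph (Fin n)) (θ : Param K) : ℝ :=
  ∑ z : Fin n → Fin K, completeLikelihood z G θ

end Likelihood

/-- `sup_{θ ∈ Θ_K} log g(A; θ)`. -/
noncomputable def maxLogLikelihood {n : ℕ} (K : ℕ) (G : SimpleGraph (Fin n)) : ℝ :=
  sSup ((fun θ : Param K => Real.log (likelihood G θ)) '' Theta K)

/-- The penalized likelihood criterion `β(K) = sup_{θ ∈ Θ_K} log g(A; θ) - N_K B`. -/
noncomputable def criterion (N : ℕ → ℝ) (B : ℝ) {n : ℕ} (G : SimpleGraph (Fin n)) (K : ℕ) : ℝ :=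
  maxLogLikelihood K G - N K * B

/-- The set `argmax` of the criterion over the candidate block numbers `1, …, Kmax`. -/
def selected (N : ℕ → ℝ) (B : ℝ) (Kmax : ℕ) {n : ℕ} (G : SimpleGraph (Fin n)) : Set ℕ :=
  {k | k ∈ Set.Icc 1 Kmax ∧ IsMaxOn (criterion N B G) (Set.Icc 1 Kmax) k}

end SBM

/-!
If `K'` blocks do at least as well as the true number `K`, some `θ' ∈ Theta K'` has likelihood at
least `exp (δ B - 1)` times that of the true parameter, where `δ = N K' - N K`. For a single
`θ'` the probability of such an event is controlled by the Hellinger affinity of the two laws. The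
supremum over the infinitely many `θ'` costs only a factor `exp (O(n))`: given the fitted labels
`z`, the likelihood depends on the graph through the edge counts between label classes, so it takes
the same value on each of polynomially many classes of graphs, and there are `K' ^ n` choices
of `z`. Hence the probability of error is at most `exp (C n - δ B / 2 - α)`, where
`exp (-α)` bounds the affinities, plus the probability of atypical true labels.

For `K' > K` the penalty alone beats `C n`, as `n ^ (-3 / 2) * ρ ^ (-1 / 2) ≤ n⁻¹` once `n ρ ≥ 1`.
For `K' < K` the affinities do: when every true class has order `n` nodes, two of them share their
majority label under `z`, and on these order `n ^ 2` pairs of nodes a single connection probability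
has to fit two different ones, at Hellinger cost of order `ρ`. So `α` has order `n ^ 2 ρ`, which
dominates both `n` and `B`.
-/

namespace SBM

open Finset Real

section Convergence

variable {ι κ : Type*} {l : Filter ι} {Ω : ι → Type*} [∀ i, MeasurableSpace (Ω i)]
  {μ : ∀ i, Measure (Ω i)} [∀ i, IsProbabilityMeasure (μ i)]

lemma tendsto_measureReal_one_iff_compl {E : ∀ i, Set (Ω i)} (hE : ∀ i, MeasurableSet (E i)) :
    Tendsto (fun i => (μ i).real (E i)) l (𝓝 1) ↔ Tendsto (fun i => (μ i).real (E i)ᶜ) l (𝓝 0) := by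
  simp only [probReal_compl_eq_one_sub (hE _)]
  exact ⟨fun h => by simpa using h.const_sub 1, fun h => by simpa using h.const_sub 1⟩

lemma tendsto_measureReal_biInter_one (s : Finset κ) {E : κ → ∀ i, Set (Ω i)}
    (hE : ∀ k i, MeasurableSet (E k i))
    (h : ∀ k ∈ s, Tendsto (fun i => (μ i).real (E k i)) l (𝓝 1)) :
    Tendsto (fun i => (μ i).real (⋂ k ∈ s, E k i)) l (𝓝 1) := by
  rw [tendsto_measureReal_one_iff_compl fun i => s.measurableSet_biInter fun k _ => hE k i]
  have hsum : Tendsto (fun i => ∑ k ∈ s, (μ i).real (E k i)ᶜ) l (𝓝 0) := by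
    simpa using tendsto_finsetSum s fun k hk =>
      (tendsto_measureReal_one_iff_compl (hE k)).1 (h k hk)
  refine squeeze_zero (fun i => measureReal_nonneg) (fun i => ?_) hsum
  rw [Set.compl_iInter₂]
  exact measureReal_biUnion_finset_le s _

end Convergence

open Classical in
lemma sum_filter_exists_le_sum {Y Z : Type*} [Fintype Y] [Fintype Z] {P : Y → ℝ}
    (hP : ∀ y, 0 ≤ P y) (p : Z → Y → Prop) :
    ∑ y with ∃ z, p z y, P y ≤ ∑ z, ∑ y with p z y, P y := by
  simp only [sum_filter]
  rw [sum_comm]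
  refine sum_le_sum fun y _ => ?_
  have hnonneg (z : Z) : 0 ≤ if p z y then P y else 0 := ite_nonneg (hP y) le_rfl
  split_ifs with h
  · obtain ⟨z, hz⟩ := h
    simpa only [if_pos hz] using single_le_sum (fun z _ => hnonneg z) (mem_univ z)
  · exact sum_nonneg fun z _ => hnonneg z

section Affinity

variable {Y : Type*} [Fintype Y]

/-- The Hellinger affinity (Bhattacharyya coefficient) of two nonnegative functions on a finite
type. They need not sum to one. -/
noncomputable def affinity (P Q : Y → ℝ) : ℝ := ∑ y, √(P y) * √(Q y)

lemma affinity_mono {P P' Q Q' : Y → ℝ} (hP : ∀ y, P y ≤ P' y) (hQ : ∀ y, Q y ≤ Q' y) :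
    affinity P Q ≤ affinity P' Q' :=
  sum_le_sum fun y _ => mul_le_mul (sqrt_le_sqrt (hP y)) (sqrt_le_sqrt (hQ y))
    (sqrt_nonneg _) (sqrt_nonneg _)

lemma sqrt_sum_le_sum_sqrt {ι : Type*} (s : Finset ι) {f : ι → ℝ} (hf : ∀ i ∈ s, 0 ≤ f i) :
    √(∑ i ∈ s, f i) ≤ ∑ i ∈ s, √(f i) := by
  refine le_sum_of_subadditive_on_pred (√·) (0 ≤ ·) sqrt_zero.le (fun x y hx hy => ?_)
    (fun x y => add_nonneg) f hf
  refine sqrt_le_iff.2 ⟨by positivity, ?_⟩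
  nlinarith [sq_sqrt hx, sq_sqrt hy, mul_nonneg (sqrt_nonneg x) (sqrt_nonneg y)]

lemma affinity_sum_left_le {ι : Type*} (s : Finset ι) {P : ι → Y → ℝ}
    (hP : ∀ i ∈ s, ∀ y, 0 ≤ P i y) (Q : Y → ℝ) :
    affinity (fun y => ∑ i ∈ s, P i y) Q ≤ ∑ i ∈ s, affinity (P i) Q := by
  simp only [affinity]
  rw [sum_comm]
  refine sum_le_sum fun y _ => ?_
  rw [← sum_mul]
  exact mul_le_mul_of_nonneg_right (sqrt_sum_le_sum_sqrt s fun i hi => hP i hi y) (sqrt_nonneg _)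

lemma sum_le_affinity_div_sqrt {P Q : Y → ℝ} (hP : ∀ y, 0 ≤ P y) (s : Finset Y) {c : ℝ}
    (hc : 0 < c) (hPQ : ∀ y ∈ s, c * P y ≤ Q y) : ∑ y ∈ s, P y ≤ affinity P Q / √c := by
  rw [le_div_iff₀ (sqrt_pos.2 hc), sum_mul]
  calc ∑ y ∈ s, P y * √c ≤ ∑ y ∈ s, √(P y) * √(Q y) := sum_le_sum fun y hy => by
        calc P y * √c = √(P y) * √(c * P y) := by
              rw [sqrt_mul hc.le, mul_left_comm, mul_self_sqrt (hP y), mul_comm]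
          _ ≤ √(P y) * √(Q y) := by gcongr; exact hPQ y hy
    _ ≤ affinity P Q := sum_le_univ_sum_of_nonneg fun y => by positivity

open Classical in
-- On a fibre of `t` every `q i` is constant, so an `i` that beats `c * P` at the point of the fibre
-- maximizing `P` beats it at all points where any member of the family does.
lemma sum_filter_exists_mul_le_of_factors {I T : Type*} [Fintype T] {P : Y → ℝ}
    (hP : ∀ y, 0 ≤ P y) {q : I → Y → ℝ} (t : Y → T)
    (hq : ∀ i y y', t y = t y' → q i y = q i y') {A c : ℝ} (hA₀ : 0 ≤ A) (hc : 0 < c)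
    (hA : ∀ i, affinity P (q i) ≤ A) :
    ∑ y with ∃ i, c * P y ≤ q i y, P y ≤ Fintype.card T * (A / √c) := by
  have hfibre (x : T) : ∑ y with (∃ i, c * P y ≤ q i y) ∧ t y = x, P y ≤ A / √c := by
    set s : Finset Y := {y | (∃ i, c * P y ≤ q i y) ∧ t y = x}
    rcases s.eq_empty_or_nonempty with hs | hs
    · rw [hs, sum_empty]
      positivity
    obtain ⟨y₀, hy₀, hmax⟩ := s.exists_max_image P hs
    obtain ⟨⟨i, hi⟩, hx⟩ := (mem_filter.1 hy₀).2
    refine (sum_le_affinity_div_sqrt hP s hc fun y hy => ?_).trans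
      (div_le_div_of_nonneg_right (hA i) (sqrt_nonneg c))
    calc c * P y ≤ c * P y₀ := by gcongr; exact hmax y hy
      _ ≤ q i y₀ := hi
      _ = q i y := hq i y₀ y (hx.trans (mem_filter.1 hy).2.2.symm)
  calc ∑ y with ∃ i, c * P y ≤ q i y, P y
      = ∑ x, ∑ y with (∃ i, c * P y ≤ q i y) ∧ t y = x, P y := by
        rw [← sum_fiberwise _ t P]
        simp only [filter_filter]
    _ ≤ ∑ _x : T, A / √c := sum_le_sum fun x _ => hfibre x
    _ = Fintype.card T * (A / √c) := by simp

open Classical in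
lemma sum_filter_exists_mul_le_sum_of_factors {I T Z : Type*} [Fintype T] [Fintype Z] [Nonempty Z]
    {P : Y → ℝ} (hP : ∀ y, 0 ≤ P y) {q : I → Z → Y → ℝ} (t : Z → Y → T)
    (hq : ∀ i z y y', t z y = t z y' → q i z y = q i z y') {A c : ℝ} (hA₀ : 0 ≤ A) (hc : 0 < c)
    (hA : ∀ i z, affinity P (q i z) ≤ A) :
    ∑ y with ∃ i, c * P y ≤ ∑ z, q i z y, P y
      ≤ Fintype.card Z * (Fintype.card T * (A / √(c / Fintype.card Z))) := by
  have : (0 : ℝ) < Fintype.card Z := by exact_mod_cast Fintype.card_pos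
  have hpigeonhole (y : Y) (h : ∃ i, c * P y ≤ ∑ z, q i z y) :
      ∃ z i, c / Fintype.card Z * P y ≤ q i z y := by
    obtain ⟨i, hi⟩ := h
    have hle : ∑ _z : Z, c / Fintype.card Z * P y ≤ ∑ z, q i z y := by
      convert hi using 1
      simp only [sum_const, card_univ, nsmul_eq_mul]
      field_simp
    obtain ⟨z, -, hz⟩ := exists_le_of_sum_le univ_nonempty hle
    exact ⟨z, i, hz⟩
  calc ∑ y with ∃ i, c * P y ≤ ∑ z, q i z y, P y
      ≤ ∑ y with ∃ z i, c / Fintype.card Z * P y ≤ q i z y, P y :=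
        sum_le_sum_of_subset_of_nonneg (monotone_filter_right _ fun y _ => hpigeonhole y)
          fun y _ _ => hP y
    _ ≤ ∑ z, ∑ y with ∃ i, c / Fintype.card Z * P y ≤ q i z y, P y :=
        sum_filter_exists_le_sum hP _
    _ ≤ ∑ _z : Z, Fintype.card T * (A / √(c / Fintype.card Z)) := sum_le_sum fun z _ =>
        sum_filter_exists_mul_le_of_factors hP (t z) (fun i => hq i z) hA₀ (by positivity)
          fun i => hA i z
    _ = Fintype.card Z * (Fintype.card T * (A / √(c / Fintype.card Z))) := by simp

end Affinity

section Bernoulli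

variable {ι : Type*} [Fintype ι]

/-- The probability of the outcome `y` of independent Bernoulli trials with success
probabilities `q`. -/
def bernoulliProb (q : ι → ℝ) (y : ι → Bool) : ℝ := ∏ i, if y i then q i else 1 - q i

/-- The squared `ℓ²` distance of the entrywise square roots of two vectors of success
probabilities: the part of the squared Hellinger distance of the two families of Bernoulli laws
that comes from the successes. -/
noncomputable def sqrtDistSq (q q' : ι → ℝ) : ℝ := ∑ i, (√(q i) - √(q' i)) ^ 2

lemma sqrtDistSq_nonneg (q q' : ι → ℝ) : 0 ≤ sqrtDistSq q q' := sum_nonneg fun _ _ => sq_nonneg _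

lemma bernoulliProb_pos {q : ι → ℝ} (hq : ∀ i, q i ∈ Set.Ioo 0 1) (y : ι → Bool) :
    0 < bernoulliProb q y := by
  refine prod_pos fun i _ => ?_
  split_ifs
  exacts [(hq i).1, sub_pos.2 (hq i).2]

lemma sum_bernoulliProb [DecidableEq ι] (q : ι → ℝ) : ∑ y, bernoulliProb q y = 1 := by
  simp only [bernoulliProb, ← Fintype.prod_sum fun i (b : Bool) => if b then q i else 1 - q i]
  simp

lemma bernoulli_affinity_le_exp {x y : ℝ} (hx : x ∈ Set.Icc 0 1) (hy : y ∈ Set.Icc 0 1) :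
    √x * √y + √(1 - x) * √(1 - y) ≤ exp (-(√x - √y) ^ 2 / 2) := by
  calc √x * √y + √(1 - x) * √(1 - y) ≤ -(√x - √y) ^ 2 / 2 + 1 := by
        nlinarith [sq_sqrt hx.1, sq_sqrt hy.1, sq_sqrt (sub_nonneg.2 hx.2),
          sq_sqrt (sub_nonneg.2 hy.2), sq_nonneg (√(1 - x) - √(1 - y))]
    _ ≤ exp (-(√x - √y) ^ 2 / 2) := add_one_le_exp _

lemma affinity_bernoulliProb_le [DecidableEq ι] {q q' : ι → ℝ} (hq : ∀ i, q i ∈ Set.Icc 0 1)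
    (hq' : ∀ i, q' i ∈ Set.Icc 0 1) :
    affinity (bernoulliProb q) (bernoulliProb q') ≤ exp (-sqrtDistSq q q' / 2) := by
  have hsqrt {x : ι → ℝ} (hx : ∀ i, x i ∈ Set.Icc 0 1) (y : ι → Bool) :
      √(bernoulliProb x y) = ∏ i, if y i then √(x i) else √(1 - x i) := by
    rw [bernoulliProb, sqrt_prod]
    · simp only [apply_ite sqrt]
    · exact fun i _ => ite_nonneg (hx i).1 (sub_nonneg.2 (hx i).2)
  calc affinity (bernoulliProb q) (bernoulliProb q')
      = ∑ y : ι → Bool, ∏ i, (if y i then √(q i) else √(1 - q i)) *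
          (if y i then √(q' i) else √(1 - q' i)) := by
        simp only [affinity, hsqrt hq, hsqrt hq', prod_mul_distrib]
    _ = ∏ i, (√(q i) * √(q' i) + √(1 - q i) * √(1 - q' i)) := by
        rw [← Fintype.prod_sum fun i (b : Bool) => (if b then √(q i) else √(1 - q i)) *
          (if b then √(q' i) else √(1 - q' i))]
        simp
    _ ≤ ∏ i, exp (-(√(q i) - √(q' i)) ^ 2 / 2) :=
        prod_le_prod (fun i _ => by positivity) fun i _ =>
          bernoulli_affinity_le_exp (hq i) (hq' i)
    _ = exp (-sqrtDistSq q q' / 2) := by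
        rw [← exp_sum, sqrtDistSq, ← sum_div, sum_neg_distrib]

end Bernoulli

section Types

variable {ι κ : Type*} [Fintype ι] [DecidableEq κ]

/-- The type, in the sense of the method of types, of a word `x` indexed by `ι`: the number of
occurrences of every letter. -/
def wordType (x : ι → κ) (a : κ) : Fin (Fintype.card ι + 1) :=
  ⟨#{i | x i = a}, Nat.lt_succ_of_le (card_le_univ _)⟩

lemma prod_eq_of_wordType_eq [Finite κ] {M : Type*} [CommMonoid M] (f : κ → M) {x x' : ι → κ}
    (h : wordType x = wordType x') : ∏ i, f (x i) = ∏ i, f (x' i) := by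
  cases nonempty_fintype κ
  have hcount (x : ι → κ) : ∏ i, f (x i) = ∏ a, f a ^ (wordType x a : ℕ) := by
    simp only [← prod_fiberwise' univ x f, prod_const, wordType]
  rw [hcount, hcount, h]

end Types

section Graphs

instance {V : Type*} [Countable V] : MeasurableSingletonClass (SimpleGraph V) where
  measurableSet_singleton G := by
    have hG : {G} = SimpleGraph.Adj ⁻¹' {G.Adj} := by
      ext G'
      simp
    exact hG ▸ SimpleGraph.measurable_adj (measurableSet_singleton _)

lemma graphOf_adj {n : ℕ} (y : Pair n → Bool) (e : Pair n) :
    (graphOf y).Adj e.1.1 e.1.2 ↔ y e = true := by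
  simp only [graphOf, SimpleGraph.fromRel_adj]
  refine ⟨?_, fun h => ⟨e.2.ne, Or.inl ⟨e.2, h⟩⟩⟩
  rintro ⟨-, ⟨_, h⟩ | ⟨h, _⟩⟩
  exacts [h, absurd h e.2.asymm]

@[to_additive]
lemma prod_offDiag_eq_prod_lt {ι M : Type*} [Fintype ι] [LinearOrder ι] [CommMonoid M]
    (w : ι × ι → M) :
    ∏ e ∈ univ.offDiag, w e = ∏ e : {e : ι × ι // e.1 < e.2}, w e * w e.1.swap := by
  rw [prod_mul_distrib, ← prod_filter_mul_prod_filter_not univ.offDiag fun e => e.1 < e.2]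
  congr 1
  · exact prod_subtype _ (by simp +contextual [ne_of_lt]) w
  · rw [← prod_subtype {e : ι × ι | e.1 < e.2} (by simp) fun e => w e.swap]
    refine prod_equiv (Equiv.prodComm ι ι) (fun e => ?_) (by simp)
    simp only [mem_filter, mem_offDiag, mem_univ, true_and, Equiv.prodComm_apply, Prod.fst_swap,
      Prod.snd_swap]
    exact ⟨fun h => (not_lt.1 h.2).lt_of_ne h.1.symm, fun h => ⟨h.ne', h.not_gt⟩⟩

end Graphs

section Likelihood

variable {n K : ℕ}

/-- The probability of the label vector `z` when the labels are independent with distribution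
`p`. -/
def labelProb (p : Fin K → ℝ) (z : Fin n → Fin K) : ℝ := ∏ i, p (z i)

/-- The conditional connection probabilities of the pairs of nodes, given the labels `z`. -/
def pairProb (H : Matrix (Fin K) (Fin K) ℝ) (z : Fin n → Fin K) (e : Pair n) : ℝ :=
  H (z e.1.1) (z e.1.2)

lemma labelProb_pos {p : Fin K → ℝ} (hp : ∀ a, 0 < p a) (z : Fin n → Fin K) : 0 < labelProb p z :=
  prod_pos fun _ _ => hp _

lemma sum_labelProb (p : Fin K → ℝ) (n : ℕ) :
    ∑ z : Fin n → Fin K, labelProb p z = (∑ a, p a) ^ n :=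
  (Fintype.sum_pow p n).symm

lemma sum_labelProb_of_mem_Theta {θ : Param K} (hθ : θ ∈ Theta K) (n : ℕ) :
    ∑ z : Fin n → Fin K, labelProb θ.prop z = 1 := by
  rw [sum_labelProb, hθ.2.1, one_pow]

lemma labelProb_le_one {θ : Param K} (hθ : θ ∈ Theta K) (z : Fin n → Fin K) :
    labelProb θ.prop z ≤ 1 :=
  sum_labelProb_of_mem_Theta hθ n ▸
    single_le_sum (fun z _ => (labelProb_pos hθ.1 z).le) (mem_univ z)

lemma pairProb_mem_Ioo {θ : Param K} (hθ : θ ∈ Theta K) (z : Fin n → Fin K) (e : Pair n) :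
    pairProb θ.conn z e ∈ Set.Ioo 0 1 := hθ.2.2.2 _ _

lemma prod_pow_nodeCount (p : Fin K → ℝ) (z : Fin n → Fin K) :
    ∏ a, p a ^ nodeCount z a = labelProb p z := by
  simp only [nodeCount, ← card_filter, labelProb, ← prod_fiberwise' univ z p, prod_const]

lemma pairCount_eq_card (z : Fin n → Fin K) (a b : Fin K) :
    pairCount z a b = #{e ∈ univ.offDiag | (z e.1, z e.2) = (a, b)} := by
  rw [pairCount, ← Fintype.sum_prod_type', ← card_filter]
  congr 1
  ext e
  simp [eq_comm]

open Classical in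
lemma edgeCount_eq_card (G : SimpleGraph (Fin n)) (z : Fin n → Fin K) (a b : Fin K) :
    edgeCount G z a b = #{e ∈ univ.offDiag | (z e.1, z e.2) = (a, b) ∧ G.Adj e.1 e.2} := by
  simp only [edgeCount, SimpleGraph.adjMatrix_apply, ← ite_and]
  rw [← Fintype.sum_prod_type', ← card_filter]
  congr 1
  ext e
  simp [eq_comm, and_assoc]

open Classical in
lemma prod_conn_pow (H : Matrix (Fin K) (Fin K) ℝ) (G : SimpleGraph (Fin n))
    (z : Fin n → Fin K) :
    ∏ a, ∏ b, H a b ^ edgeCount G z a b * (1 - H a b) ^ (pairCount z a b - edgeCount G z a b)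
      = ∏ e ∈ univ.offDiag,
          if G.Adj e.1 e.2 then H (z e.1) (z e.2) else 1 - H (z e.1) (z e.2) := by
  rw [← Fintype.prod_prod_type', ← prod_fiberwise univ.offDiag fun e => (z e.1, z e.2)]
  refine prod_congr rfl fun ab _ => ?_
  have hcard := card_filter_add_card_filter_not
    (s := {e ∈ univ.offDiag | (z e.1, z e.2) = ab}) fun e => G.Adj e.1 e.2
  rw [filter_filter, ← edgeCount_eq_card, ← pairCount_eq_card] at hcard
  rw [Nat.sub_eq_of_eq_add' hcard.symm, edgeCount_eq_card, ← prod_const, ← prod_const,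
    ← filter_filter, ← prod_ite]
  refine prod_congr rfl fun e he => ?_
  obtain rfl := (mem_filter.1 he).2
  rfl

lemma completeLikelihood_graphOf {θ : Param K} (hθ : θ ∈ Theta K) (z : Fin n → Fin K)
    (y : Pair n → Bool) :
    completeLikelihood z (graphOf y) θ
      = labelProb θ.prop z * bernoulliProb (pairProb θ.conn z) y := by
  rw [completeLikelihood, prod_pow_nodeCount, prod_conn_pow, prod_offDiag_eq_prod_lt]
  congr 1
  rw [sqrt_eq_iff_mul_self_eq_of_pos (bernoulliProb_pos (pairProb_mem_Ioo hθ z) y), bernoulliProb,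
    ← prod_mul_distrib]
  refine prod_congr rfl fun e _ => ?_
  simp only [Prod.fst_swap, Prod.snd_swap, SimpleGraph.adj_comm _ e.1.2 e.1.1,
    hθ.2.2.1.apply (z e.1.1) (z e.1.2), graphOf_adj, pairProb]

lemma likelihood_graphOf {θ : Param K} (hθ : θ ∈ Theta K) (y : Pair n → Bool) :
    likelihood (graphOf y) θ
      = ∑ z, labelProb θ.prop z * bernoulliProb (pairProb θ.conn z) y :=
  sum_congr rfl fun z _ => completeLikelihood_graphOf hθ z y

end Likelihood

section Law

variable {n K : ℕ}

lemma bernoulliLaw_singleton {q : ℝ} (hq : q ∈ Set.Icc 0 1) (b : Bool) :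
    bernoulliLaw q {b} = ENNReal.ofReal (if b then q else 1 - q) := by
  rw [bernoulliLaw, Set.projIcc_of_mem zero_le_one hq, ← ofReal_measureReal,
    ProbabilityTheory.bernoulliMeasure_real_apply _ (measurableSet_singleton b)]
  cases b <;> simp

lemma labelLaw_singleton (θ : Param K) (a : Fin K) :
    labelLaw θ {a} = ENNReal.ofReal (θ.prop a) := by
  simp [labelLaw, Measure.finsetSum_apply, Set.indicator_apply, eq_comm]

lemma isProbabilityMeasure_labelLaw {θ : Param K} (hθ : θ ∈ Theta K) :
    IsProbabilityMeasure (labelLaw θ) where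
  measure_univ := by
    rw [← Finset.coe_univ, ← sum_measure_singleton]
    simp only [labelLaw_singleton]
    rw [← ENNReal.ofReal_sum_of_nonneg fun a _ => (hθ.1 a).le, hθ.2.1, ENNReal.ofReal_one]

lemma labelsLaw_singleton {θ : Param K} (hθ : θ ∈ Theta K) (z : Fin n → Fin K) :
    labelsLaw n θ {z} = ENNReal.ofReal (labelProb θ.prop z) := by
  have := isProbabilityMeasure_labelLaw hθ
  simp only [labelsLaw, Measure.pi_singleton, labelLaw_singleton, labelProb,
    ENNReal.ofReal_prod_of_nonneg fun i _ => (hθ.1 (z i)).le]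

instance (q : ℝ) : IsProbabilityMeasure (bernoulliLaw q) := by
  unfold bernoulliLaw
  infer_instance

instance (θ : Param K) (z : Fin n → Fin K) : IsProbabilityMeasure (condLaw θ z) := by
  unfold condLaw
  exact Measure.isProbabilityMeasure_map (measurable_of_finite _).aemeasurable

lemma isProbabilityMeasure_law {θ : Param K} (hθ : θ ∈ Theta K) :
    IsProbabilityMeasure (law n θ) := by
  have := isProbabilityMeasure_labelLaw hθ
  unfold law labelsLaw
  exact isProbabilityMeasure_bind (measurable_of_finite _).aemeasurable (ae_of_all _ inferInstance)

open Classical in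
lemma condLaw_apply {θ : Param K} (hθ : θ ∈ Theta K) (z : Fin n → Fin K)
    (E : Set (SimpleGraph (Fin n))) :
    condLaw θ z E
      = ENNReal.ofReal (∑ y with graphOf y ∈ E, bernoulliProb (pairProb θ.conn z) y) := by
  have hsingle (y : Pair n → Bool) :
      (Measure.pi fun e : Pair n => bernoulliLaw (θ.conn (z e.1.1) (z e.1.2))) {y}
        = ENNReal.ofReal (bernoulliProb (pairProb θ.conn z) y) := by
    rw [Measure.pi_singleton, bernoulliProb, ENNReal.ofReal_prod_of_nonneg fun e _ => ite_nonneg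
      (pairProb_mem_Ioo hθ z e).1.le (sub_nonneg.2 (pairProb_mem_Ioo hθ z e).2.le)]
    exact prod_congr rfl fun e _ =>
      bernoulliLaw_singleton (Set.Ioo_subset_Icc_self (pairProb_mem_Ioo hθ z e)) (y e)
  rw [condLaw, Measure.map_apply (measurable_of_finite _) E.toFinite.measurableSet,
    ENNReal.ofReal_sum_of_nonneg fun y _ => (bernoulliProb_pos (pairProb_mem_Ioo hθ z) y).le]
  simp only [← hsingle, sum_measure_singleton, coe_filter_univ]
  rfl

open Classical in
lemma law_real_apply {θ : Param K} (hθ : θ ∈ Theta K) (E : Set (SimpleGraph (Fin n))) :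
    (law n θ).real E = ∑ y with graphOf y ∈ E, likelihood (graphOf y) θ := by
  have hcond (z : Fin n → Fin K) :
      0 ≤ ∑ y with graphOf y ∈ E, bernoulliProb (pairProb θ.conn z) y :=
    sum_nonneg fun y _ => (bernoulliProb_pos (pairProb_mem_Ioo hθ z) y).le
  calc (law n θ).real E
      = ∑ z, labelProb θ.prop z *
          ∑ y with graphOf y ∈ E, bernoulliProb (pairProb θ.conn z) y := by
        rw [measureReal_def, law, Measure.bind_apply E.toFinite.measurableSet
          (measurable_of_finite _).aemeasurable, lintegral_fintype]
        simp only [labelsLaw_singleton hθ, condLaw_apply hθ]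
        rw [ENNReal.toReal_sum (by finiteness)]
        refine sum_congr rfl fun z _ => ?_
        rw [ENNReal.toReal_mul, ENNReal.toReal_ofReal (hcond z),
          ENNReal.toReal_ofReal (labelProb_pos hθ.1 z).le, mul_comm]
    _ = ∑ y with graphOf y ∈ E, likelihood (graphOf y) θ := by
        simp only [mul_sum, likelihood_graphOf hθ]
        exact sum_comm

end Law

section MaxLikelihood

variable {n K : ℕ}

lemma one_le_of_mem_Theta {θ : Param K} (hθ : θ ∈ Theta K) : 1 ≤ K := by
  by_contra! h
  obtain rfl : K = 0 := by omega
  simpa using hθ.2.1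

lemma Theta_nonempty (hK : 1 ≤ K) : (Theta K).Nonempty := by
  refine ⟨⟨fun _ => (K : ℝ)⁻¹, fun _ _ => 1 / 2⟩, fun _ => by positivity, ?_, rfl, fun _ _ => ?_⟩
  · simp [show K ≠ 0 by omega]
  · constructor <;> norm_num

lemma likelihood_graphOf_pos {θ : Param K} (hθ : θ ∈ Theta K) (y : Pair n → Bool) :
    0 < likelihood (graphOf y) θ := by
  have : NeZero K := ⟨by have := one_le_of_mem_Theta hθ; omega⟩
  rw [likelihood_graphOf hθ]
  exact sum_pos (fun z _ => mul_pos (labelProb_pos hθ.1 z)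
    (bernoulliProb_pos (pairProb_mem_Ioo hθ z) y)) univ_nonempty

lemma sum_likelihood_graphOf {θ : Param K} (hθ : θ ∈ Theta K) :
    ∑ y : Pair n → Bool, likelihood (graphOf y) θ = 1 := by
  have := isProbabilityMeasure_law (n := n) hθ
  have h := law_real_apply (n := n) hθ Set.univ
  simpa using h.symm

lemma likelihood_graphOf_le_one {θ : Param K} (hθ : θ ∈ Theta K) (y : Pair n → Bool) :
    likelihood (graphOf y) θ ≤ 1 :=
  sum_likelihood_graphOf (n := n) hθ ▸
    single_le_sum (fun y _ => (likelihood_graphOf_pos hθ y).le) (mem_univ y)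

lemma log_likelihood_le_maxLogLikelihood {θ : Param K} (hθ : θ ∈ Theta K) (y : Pair n → Bool) :
    log (likelihood (graphOf y) θ) ≤ maxLogLikelihood K (graphOf y) := by
  refine le_csSup ⟨0, ?_⟩ (Set.mem_image_of_mem _ hθ)
  rintro _ ⟨θ', hθ', rfl⟩
  exact log_nonpos (likelihood_graphOf_pos hθ' y).le (likelihood_graphOf_le_one hθ' y)

lemma exists_mul_likelihood_le_of_criterion_le {K' : ℕ} {θ : Param K} (hθ : θ ∈ Theta K)
    (hK' : 1 ≤ K') {N : ℕ → ℝ} {B : ℝ} {y : Pair n → Bool}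
    (h : criterion N B (graphOf y) K ≤ criterion N B (graphOf y) K') :
    ∃ θ' ∈ Theta K',
      exp ((N K' - N K) * B - 1) * likelihood (graphOf y) θ ≤ likelihood (graphOf y) θ' := by
  obtain ⟨_, ⟨θ', hθ', rfl⟩, hlt⟩ := exists_lt_of_lt_csSup ((Theta_nonempty hK').image
    fun θ => log (likelihood (graphOf y) θ)) (sub_one_lt (maxLogLikelihood K' (graphOf y)))
  dsimp only at hlt
  refine ⟨θ', hθ', ?_⟩
  rw [← log_le_log_iff (mul_pos (exp_pos _) (likelihood_graphOf_pos hθ y))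
    (likelihood_graphOf_pos hθ' y), log_mul (exp_ne_zero _) (likelihood_graphOf_pos hθ y).ne',
    log_exp]
  have hmax := log_likelihood_le_maxLogLikelihood hθ y
  simp only [criterion] at h
  linarith

end MaxLikelihood

section FiniteSample

variable {n K K' : ℕ}

/-- The part of the likelihood contributed by the label vectors in `good`. -/
noncomputable def restrictedLikelihood (good : Finset (Fin n → Fin K)) (θ : Param K)
    (y : Pair n → Bool) : ℝ :=
  ∑ Z ∈ good, labelProb θ.prop Z * bernoulliProb (pairProb θ.conn Z) y

lemma labelProb_mul_bernoulliProb_nonneg {θ : Param K} (hθ : θ ∈ Theta K) (Z : Fin n → Fin K)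
    (y : Pair n → Bool) : 0 ≤ labelProb θ.prop Z * bernoulliProb (pairProb θ.conn Z) y :=
  mul_nonneg (labelProb_pos hθ.1 Z).le (bernoulliProb_pos (pairProb_mem_Ioo hθ Z) y).le

lemma restrictedLikelihood_nonneg {θ : Param K} (hθ : θ ∈ Theta K)
    (good : Finset (Fin n → Fin K)) (y : Pair n → Bool) : 0 ≤ restrictedLikelihood good θ y :=
  sum_nonneg fun Z _ => labelProb_mul_bernoulliProb_nonneg hθ Z y

lemma restrictedLikelihood_le_likelihood {θ : Param K} (hθ : θ ∈ Theta K)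
    (good : Finset (Fin n → Fin K)) (y : Pair n → Bool) :
    restrictedLikelihood good θ y ≤ likelihood (graphOf y) θ := by
  rw [likelihood_graphOf hθ]
  exact sum_le_univ_sum_of_nonneg fun Z => labelProb_mul_bernoulliProb_nonneg hθ Z y

lemma sum_restrictedLikelihood (good : Finset (Fin n → Fin K)) (θ : Param K) :
    ∑ y, restrictedLikelihood good θ y = ∑ Z ∈ good, labelProb θ.prop Z := by
  simp only [restrictedLikelihood]
  rw [sum_comm]
  simp only [← mul_sum, sum_bernoulliProb, mul_one]

open Classical in
lemma law_real_le_sum_compl_add {θ : Param K} (hθ : θ ∈ Theta K) (E : Set (SimpleGraph (Fin n)))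
    (good : Finset (Fin n → Fin K)) :
    (law n θ).real E ≤ ∑ Z ∈ goodᶜ, labelProb θ.prop Z
      + ∑ y with graphOf y ∈ E, restrictedLikelihood good θ y := by
  have hsplit (y : Pair n → Bool) : likelihood (graphOf y) θ
      = restrictedLikelihood goodᶜ θ y + restrictedLikelihood good θ y := by
    rw [likelihood_graphOf hθ, restrictedLikelihood, restrictedLikelihood, sum_compl_add_sum]
  simp only [law_real_apply hθ, hsplit, sum_add_distrib]
  gcongr
  rw [← sum_restrictedLikelihood]
  exact sum_le_univ_sum_of_nonneg fun y => restrictedLikelihood_nonneg hθ goodᶜ y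

lemma affinity_restrictedLikelihood_le {θ : Param K} (hθ : θ ∈ Theta K) {θ' : Param K'}
    (hθ' : θ' ∈ Theta K') {good : Finset (Fin n → Fin K)} (z : Fin n → Fin K') {α : ℝ}
    (hα : ∀ Z ∈ good, 2 * α ≤ sqrtDistSq (pairProb θ.conn Z) (pairProb θ'.conn z)) :
    affinity (restrictedLikelihood good θ)
        (fun y => labelProb θ'.prop z * bernoulliProb (pairProb θ'.conn z) y)
      ≤ K ^ n * exp (-α) := by
  have hterm (Z : Fin n → Fin K) (hZ : Z ∈ good) :
      affinity (fun y => labelProb θ.prop Z * bernoulliProb (pairProb θ.conn Z) y)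
        (fun y => labelProb θ'.prop z * bernoulliProb (pairProb θ'.conn z) y) ≤ exp (-α) := by
    calc _ ≤ affinity (bernoulliProb (pairProb θ.conn Z)) (bernoulliProb (pairProb θ'.conn z)) :=
          affinity_mono
            (fun y => mul_le_of_le_one_left (bernoulliProb_pos (pairProb_mem_Ioo hθ Z) y).le
              (labelProb_le_one hθ Z))
            (fun y => mul_le_of_le_one_left (bernoulliProb_pos (pairProb_mem_Ioo hθ' z) y).le
              (labelProb_le_one hθ' z))
      _ ≤ exp (-sqrtDistSq (pairProb θ.conn Z) (pairProb θ'.conn z) / 2) :=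
          affinity_bernoulliProb_le (fun e => Set.Ioo_subset_Icc_self (pairProb_mem_Ioo hθ Z e))
            fun e => Set.Ioo_subset_Icc_self (pairProb_mem_Ioo hθ' z e)
      _ ≤ exp (-α) := exp_le_exp.2 (by linarith [hα Z hZ])
  calc _ ≤ ∑ Z ∈ good, affinity (fun y => labelProb θ.prop Z * bernoulliProb (pairProb θ.conn Z) y)
        (fun y => labelProb θ'.prop z * bernoulliProb (pairProb θ'.conn z) y) :=
        affinity_sum_left_le good (fun Z _ => labelProb_mul_bernoulliProb_nonneg hθ Z) _
    _ ≤ #good * exp (-α) := by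
        rw [← nsmul_eq_mul]
        exact sum_le_card_nsmul good _ _ hterm
    _ ≤ K ^ n * exp (-α) := by
        gcongr
        exact_mod_cast (card_le_univ good).trans_eq (by simp)

/-- The exponential rate of the union bound: a factor `K ^ n` for the true labels, `K' ^ (3n/2)`
for the fitted ones, and at most `exp (4 * K' ^ 2 * n)` types of the word
`e ↦ (z_i, z_j, A_{i,j})`, `e = (i, j)`, in an alphabet of `2 * K' ^ 2` letters. -/
noncomputable def unionRate (K K' : ℕ) : ℝ := log K + 3 / 2 * log K' + 4 * K' ^ 2

lemma card_pair_add_one_le_exp (n : ℕ) : (Fintype.card (Pair n) + 1 : ℝ) ≤ exp (2 * n) := by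
  have hcard : (Fintype.card (Pair n) : ℝ) ≤ n * n := by
    exact_mod_cast (Fintype.card_subtype_le _).trans_eq (by simp)
  calc (Fintype.card (Pair n) + 1 : ℝ) ≤ (n + 1) ^ 2 := by nlinarith [n.cast_nonneg (α := ℝ)]
    _ ≤ exp n ^ 2 := by gcongr; exact add_one_le_exp _
    _ = exp (2 * n) := by rw [← exp_nat_mul]; norm_num

lemma union_bound_le_exp (n : ℕ) (hK : 1 ≤ K) (hK' : 1 ≤ K') (D α : ℝ) :
    (K' : ℝ) ^ n * ((Fintype.card (Pair n) + 1) ^ (K' * (K' * 2)) *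
        (K ^ n * exp (-α) / √(exp D / K' ^ n)))
      ≤ exp (unionRate K K' * n - D / 2 - α) := by
  have hpow {k : ℕ} (hk : 1 ≤ k) : (k : ℝ) ^ n = exp (log k * n) := by
    rw [mul_comm, exp_nat_mul, exp_log (by exact_mod_cast hk)]
  calc _ ≤ exp (log K' * n) * (exp (2 * n) ^ (K' * (K' * 2)) *
        (exp (log K * n) * exp (-α) / √(exp D / exp (log K' * n)))) := by
        rw [hpow hK, hpow hK']
        gcongr
        exact card_pair_add_one_le_exp n
    _ = exp (unionRate K K' * n - D / 2 - α) := by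
        rw [← exp_sub, sqrt_eq_rpow, ← exp_mul, ← exp_nat_mul, ← exp_add, ← exp_sub, ← exp_add,
          ← exp_add, unionRate]
        congr 1
        push_cast
        ring

lemma bernoulliProb_pairProb_eq_of_wordType_eq (H : Matrix (Fin K) (Fin K) ℝ) (z : Fin n → Fin K)
    {y y' : Pair n → Bool} (h : wordType (fun e : Pair n => (z e.1.1, z e.1.2, y e))
      = wordType fun e : Pair n => (z e.1.1, z e.1.2, y' e)) :
    bernoulliProb (pairProb H z) y = bernoulliProb (pairProb H z) y' :=
  prod_eq_of_wordType_eq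
    (fun a : Fin K × Fin K × Bool => if a.2.2 then H a.1 a.2.1 else 1 - H a.1 a.2.1) h

lemma measureReal_le_of_exists_exp_mul_likelihood_le {θ : Param K} (hθ : θ ∈ Theta K)
    (hK' : 1 ≤ K') (good : Finset (Fin n → Fin K)) {α D : ℝ}
    (hα : ∀ Z ∈ good, ∀ z : Fin n → Fin K', ∀ θ' ∈ Theta K',
      2 * α ≤ sqrtDistSq (pairProb θ.conn Z) (pairProb θ'.conn z))
    {E : Set (SimpleGraph (Fin n))} (hE : ∀ y, graphOf y ∈ E → ∃ θ' ∈ Theta K',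
      exp D * likelihood (graphOf y) θ ≤ likelihood (graphOf y) θ') :
    (law n θ).real E
      ≤ ∑ Z ∈ goodᶜ, labelProb θ.prop Z + exp (unionRate K K' * n - D / 2 - α) := by
  classical
  have : Nonempty (Fin K') := ⟨⟨0, hK'⟩⟩
  have hexists (y : Pair n → Bool) (hy : graphOf y ∈ E) :
      ∃ θ' : Theta K', exp D * restrictedLikelihood good θ y
        ≤ ∑ z, labelProb θ'.1.prop z * bernoulliProb (pairProb θ'.1.conn z) y := by
    obtain ⟨θ', hθ', hle⟩ := hE y hy
    refine ⟨⟨θ', hθ'⟩, ?_⟩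
    rw [← likelihood_graphOf hθ']
    exact le_trans (by gcongr; exact restrictedLikelihood_le_likelihood hθ good y) hle
  refine (law_real_le_sum_compl_add hθ E good).trans ?_
  gcongr
  calc ∑ y with graphOf y ∈ E, restrictedLikelihood good θ y
      ≤ ∑ y with ∃ θ' : Theta K', exp D * restrictedLikelihood good θ y
          ≤ ∑ z, labelProb θ'.1.prop z * bernoulliProb (pairProb θ'.1.conn z) y,
          restrictedLikelihood good θ y :=
        sum_le_sum_of_subset_of_nonneg (monotone_filter_right _ fun y _ => hexists y)
          fun y _ _ => restrictedLikelihood_nonneg hθ good y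
    _ ≤ _ := sum_filter_exists_mul_le_sum_of_factors (restrictedLikelihood_nonneg hθ good)
        (q := fun (θ' : Theta K') z y =>
          labelProb θ'.1.prop z * bernoulliProb (pairProb θ'.1.conn z) y)
        (fun z y => wordType fun e => (z e.1.1, z e.1.2, y e))
        (fun θ' z y y' h => congrArg (labelProb θ'.1.prop z * ·)
          (bernoulliProb_pairProb_eq_of_wordType_eq θ'.1.conn z h))
        (by positivity) (exp_pos D)
        fun θ' z => affinity_restrictedLikelihood_le hθ θ'.2 z fun Z hZ => hα Z hZ z θ'.1 θ'.2
    _ ≤ exp (unionRate K K' * n - D / 2 - α) := by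
        simpa using union_bound_le_exp n (one_le_of_mem_Theta hθ) hK' D α

lemma measureReal_compl_criterion_lt_le {θ : Param K} (hθ : θ ∈ Theta K) (hK' : 1 ≤ K')
    (N : ℕ → ℝ) (B : ℝ) (good : Finset (Fin n → Fin K)) {α : ℝ}
    (hα : ∀ Z ∈ good, ∀ z : Fin n → Fin K', ∀ θ' ∈ Theta K',
      2 * α ≤ sqrtDistSq (pairProb θ.conn Z) (pairProb θ'.conn z)) :
    (law n θ).real {G | criterion N B G K' < criterion N B G K}ᶜ
      ≤ ∑ Z ∈ goodᶜ, labelProb θ.prop Z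
        + exp (unionRate K K' * n - ((N K' - N K) * B - 1) / 2 - α) :=
  measureReal_le_of_exists_exp_mul_likelihood_le hθ hK' good hα fun _ hy =>
    exists_mul_likelihood_le_of_criterion_le hθ hK' (not_lt.1 hy)

end FiniteSample

section Balanced

variable {n K : ℕ}

-- Chernoff's bound for the binomial variable `nodeCount Z a`, with exponential parameter `-1`.
lemma sum_labelProb_filter_nodeCount_lt_le {p : Fin K → ℝ} (hp : ∀ a, 0 < p a)
    (hp1 : ∑ a, p a = 1) (a : Fin K) (t : ℝ) :
    ∑ Z : Fin n → Fin K with (nodeCount Z a : ℝ) < t, labelProb p Z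
      ≤ exp (t - p a * (1 - exp (-1)) * n) := by
  set w : Fin K → ℝ := fun b => p b * if b = a then exp (-1) else 1
  have hw (Z : Fin n → Fin K) : labelProb w Z = labelProb p Z * exp (-nodeCount Z a) := by
    simp only [labelProb, w, prod_mul_distrib, prod_ite, prod_const, one_pow, mul_one, nodeCount,
      ← card_filter, ← exp_nat_mul, mul_neg]
  have hw_nonneg (b : Fin K) : 0 ≤ w b := mul_nonneg (hp b).le (by positivity)
  have hsum : ∑ b, w b ≤ exp (-(p a * (1 - exp (-1)))) := by
    have hw_eq (b : Fin K) : w b = p b + if b = a then p b * (exp (-1) - 1) else 0 := by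
      simp only [w]
      split_ifs <;> ring
    simp only [hw_eq, sum_add_distrib, hp1, sum_ite_eq', mem_univ, if_true]
    linarith [add_one_le_exp (-(p a * (1 - exp (-1))))]
  calc ∑ Z : Fin n → Fin K with (nodeCount Z a : ℝ) < t, labelProb p Z
      ≤ ∑ Z : Fin n → Fin K with (nodeCount Z a : ℝ) < t, exp t * labelProb w Z := by
        refine sum_le_sum fun Z hZ => ?_
        rw [hw, mul_left_comm, ← exp_add]
        refine le_mul_of_one_le_right (labelProb_pos hp Z).le (one_le_exp ?_)
        linarith [(mem_filter.1 hZ).2]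
    _ ≤ ∑ Z : Fin n → Fin K, exp t * labelProb w Z := sum_le_univ_sum_of_nonneg fun Z =>
        mul_nonneg (exp_pos t).le (prod_nonneg fun i _ => hw_nonneg (Z i))
    _ = exp t * (∑ b, w b) ^ n := by rw [← mul_sum, sum_labelProb]
    _ ≤ exp t * exp (-(p a * (1 - exp (-1)))) ^ n := by
        have := sum_nonneg fun b (_ : b ∈ univ) => hw_nonneg b
        gcongr
    _ = exp (t - p a * (1 - exp (-1)) * n) := by
        rw [← exp_nat_mul, ← exp_add]
        ring_nf

/-- The label vectors that use every label at least `t` times. -/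
noncomputable def balancedLabels (n K : ℕ) (t : ℝ) : Finset (Fin n → Fin K) :=
  {Z | ∀ a, t ≤ nodeCount Z a}

lemma sum_labelProb_compl_balancedLabels_le {p : Fin K → ℝ} (hp : ∀ a, 0 < p a)
    (hp1 : ∑ a, p a = 1) {r : ℝ} (hr : ∀ a, r ≤ p a) (t : ℝ) :
    ∑ Z ∈ (balancedLabels n K t)ᶜ, labelProb p Z ≤ K * exp (t - r * (1 - exp (-1)) * n) := by
  have hcompl : (balancedLabels n K t)ᶜ
      = ({Z | ∃ a, (nodeCount Z a : ℝ) < t} : Finset (Fin n → Fin K)) := by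
    ext Z
    simp [balancedLabels]
  have hexp : 0 ≤ 1 - exp (-1) := sub_nonneg.2 (exp_le_one_iff.2 (by norm_num))
  rw [hcompl]
  calc ∑ Z : Fin n → Fin K with ∃ a, (nodeCount Z a : ℝ) < t, labelProb p Z
      ≤ ∑ a, ∑ Z : Fin n → Fin K with (nodeCount Z a : ℝ) < t, labelProb p Z := by
        convert sum_filter_exists_le_sum (fun Z => (labelProb_pos hp Z).le) _
    _ ≤ ∑ _a : Fin K, exp (t - r * (1 - exp (-1)) * n) := sum_le_sum fun a _ =>
        (sum_labelProb_filter_nodeCount_lt_le hp hp1 a t).trans (by gcongr; exact hr a)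
    _ = K * exp (t - r * (1 - exp (-1)) * n) := by simp

end Balanced

section Separation

lemma card_mul_card_sub_one_le {ι : Type*} [DecidableEq ι] (U V : Finset ι) :
    #U * (#V - 1) ≤ #{e ∈ U ×ˢ V | e.1 ≠ e.2} := by
  have hdiag : #{e ∈ U ×ˢ V | e.1 = e.2} ≤ #U := by
    refine card_le_card_of_injOn Prod.fst (fun e he => (mem_product.1 (mem_filter.1 he).1).1)
      fun e he e' he' h => Prod.ext h ?_
    rw [← (mem_filter.1 he).2, ← (mem_filter.1 he').2, h]
  have hsplit := card_filter_add_card_filter_not (s := U ×ˢ V) fun e => e.1 = e.2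
  rw [card_product] at hsplit
  rw [Nat.mul_sub_one, Nat.sub_le_iff_le_add', ← hsplit]
  gcongr

lemma mul_sub_one_mul_le_sum_block {ι : Type*} [DecidableEq ι] {U V : Finset ι} {t x : ℝ}
    (ht : 1 ≤ t) (hU : t ≤ #U) (hV : t ≤ #V) {d : ι × ι → ℝ} (hx : 0 ≤ x)
    (hd : ∀ i ∈ U, ∀ j ∈ V, d (i, j) = x) :
    t * (t - 1) * x ≤ ∑ e ∈ U ×ˢ V with e.1 ≠ e.2, d e := by
  have hsum : ∑ e ∈ U ×ˢ V with e.1 ≠ e.2, d e = #{e ∈ U ×ˢ V | e.1 ≠ e.2} * x := by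
    rw [← nsmul_eq_mul, ← sum_const]
    refine sum_congr rfl fun e he => ?_
    obtain ⟨hi, hj⟩ := mem_product.1 (mem_filter.1 he).1
    exact hd e.1 hi e.2 hj
  have hV1 : 1 ≤ #V := by exact_mod_cast ht.trans hV
  rw [hsum]
  gcongr
  calc t * (t - 1) ≤ #U * (#V - 1) := by gcongr
    _ ≤ #{e ∈ U ×ˢ V | e.1 ≠ e.2} := by exact_mod_cast card_mul_card_sub_one_le U V

lemma mul_sub_one_mul_add_le_sum_offDiag {ι : Type*} [Fintype ι]
    {U V W : Finset ι} (hVW : Disjoint V W) {t x y : ℝ} (ht : 1 ≤ t) (hU : t ≤ #U) (hV : t ≤ #V)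
    (hW : t ≤ #W) {d : ι × ι → ℝ} (hd : ∀ e, 0 ≤ d e) (hx : 0 ≤ x) (hy : 0 ≤ y)
    (hdV : ∀ i ∈ U, ∀ j ∈ V, d (i, j) = x) (hdW : ∀ i ∈ U, ∀ j ∈ W, d (i, j) = y) :
    t * (t - 1) * (x + y) ≤ ∑ e ∈ univ.offDiag, d e := by
  classical
  have hdisj : Disjoint {e ∈ U ×ˢ V | e.1 ≠ e.2} {e ∈ U ×ˢ W | e.1 ≠ e.2} :=
    disjoint_filter_filter (disjoint_product.2 (Or.inr hVW))
  calc t * (t - 1) * (x + y) = t * (t - 1) * x + t * (t - 1) * y := mul_add _ _ _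
    _ ≤ ∑ e ∈ U ×ˢ V with e.1 ≠ e.2, d e + ∑ e ∈ U ×ˢ W with e.1 ≠ e.2, d e :=
        add_le_add (mul_sub_one_mul_le_sum_block ht hU hV hx hdV)
          (mul_sub_one_mul_le_sum_block ht hU hW hy hdW)
    _ = ∑ e ∈ {e ∈ U ×ˢ V | e.1 ≠ e.2} ∪ {e ∈ U ×ˢ W | e.1 ≠ e.2}, d e :=
        (sum_union hdisj).symm
    _ ≤ ∑ e ∈ univ.offDiag, d e :=
        sum_le_sum_of_subset_of_nonneg (by simp +contextual [subset_iff, or_imp]) fun e _ _ => hd e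

variable {n K K' : ℕ}

lemma exists_le_card_filter_and {Z : Fin n → Fin K} {a : Fin K} (hK' : 1 ≤ K')
    (z : Fin n → Fin K') {t : ℝ} (hZ : K' * t ≤ nodeCount Z a) :
    ∃ m, t ≤ #{i | Z i = a ∧ z i = m} := by
  have : Nonempty (Fin K') := ⟨⟨0, hK'⟩⟩
  obtain ⟨m, -, hm⟩ := exists_le_card_fiber_of_nsmul_le_card_of_maps_to (s := {i | Z i = a})
    (t := univ) (f := z) (b := t) (fun _ _ => mem_univ _) univ_nonempty
    (by simpa [nodeCount, ← card_filter] using hZ)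
  exact ⟨m, by rwa [filter_filter] at hm⟩

lemma two_mul_sqrtDistSq_pairProb {H : Matrix (Fin K) (Fin K) ℝ} (hH : H.IsSymm)
    {H' : Matrix (Fin K') (Fin K') ℝ} (hH' : H'.IsSymm) (Z : Fin n → Fin K) (z : Fin n → Fin K') :
    2 * sqrtDistSq (pairProb H Z) (pairProb H' z)
      = ∑ e ∈ univ.offDiag, (√(H (Z e.1) (Z e.2)) - √(H' (z e.1) (z e.2))) ^ 2 := by
  rw [sum_offDiag_eq_sum_lt, sqrtDistSq, mul_sum]
  refine sum_congr rfl fun e _ => ?_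
  rw [Prod.fst_swap, Prod.snd_swap, hH.apply (Z e.1.1), hH'.apply (z e.1.1), ← two_mul]
  rfl

-- With fewer than `K` labels available, two classes `a ≠ b` of `Z` have the same majority label,
-- so that a single entry of `H'` has to approximate both `H c a` and `H c b`.
lemma le_sqrtDistSq_pairProb_of_lt (hK' : 1 ≤ K') (hK : K' < K) {H : Matrix (Fin K) (Fin K) ℝ}
    (hH : H.IsSymm) {Δ : ℝ} (hΔ : ∀ a b, a ≠ b → ∃ c, Δ ≤ (√(H c a) - √(H c b)) ^ 2)
    {H' : Matrix (Fin K') (Fin K') ℝ} (hH' : H'.IsSymm) {t : ℝ} (ht : 2 ≤ t) {Z : Fin n → Fin K}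
    (hZ : ∀ a, K' * t ≤ nodeCount Z a) (z : Fin n → Fin K') :
    t ^ 2 * Δ / 8 ≤ sqrtDistSq (pairProb H Z) (pairProb H' z) := by
  choose m hm using fun a => exists_le_card_filter_and hK' z (hZ a)
  obtain ⟨a, b, hab, hmab⟩ := Fintype.exists_ne_map_eq_of_card_lt m (by simpa using hK)
  obtain ⟨c, hc⟩ := hΔ a b hab
  set h := √(H' (m c) (m a))
  have hblocks : t * (t - 1) * ((√(H c a) - h) ^ 2 + (√(H c b) - h) ^ 2)
      ≤ 2 * sqrtDistSq (pairProb H Z) (pairProb H' z) := by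
    rw [two_mul_sqrtDistSq_pairProb hH hH']
    refine mul_sub_one_mul_add_le_sum_offDiag ?_ (by linarith) (hm c) (hm a) (hm b)
      (fun e => sq_nonneg _) (sq_nonneg _) (sq_nonneg _) ?_ ?_
    · exact disjoint_filter.2 fun j _ ha hb => hab (ha.1.symm.trans hb.1)
    all_goals
      simp only [mem_filter, mem_univ, true_and, and_imp]
      rintro i hi hi' j hj hj'
      simp only [hi, hi', hj, hj', hmab, h]
  have hmid : Δ / 2 ≤ (√(H c a) - h) ^ 2 + (√(H c b) - h) ^ 2 := by
    nlinarith [sq_nonneg ((√(H c a) - h) + (√(H c b) - h))]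
  have hsq : t ^ 2 / 2 ≤ t * (t - 1) := by nlinarith
  calc t ^ 2 * Δ / 8 = t ^ 2 / 2 * (Δ / 2) / 2 := by ring
    _ ≤ t * (t - 1) * ((√(H c a) - h) ^ 2 + (√(H c b) - h) ^ 2) / 2 := by
        gcongr ?_ / 2
        exact (mul_le_mul_of_nonneg_left hmid (by positivity)).trans
          (mul_le_mul_of_nonneg_right hsq (by positivity))
    _ ≤ sqrtDistSq (pairProb H Z) (pairProb H' z) := by linarith

end Separation

section Asymptotics

variable {ρ B : ℕ → ℝ}

lemma tendsto_mul_atTop_of_div_log (hρ_pos : ∀ n, 0 < ρ n)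
    (hρ : Tendsto (fun n : ℕ => n * ρ n / log n) atTop atTop) :
    Tendsto (fun n : ℕ => n * ρ n) atTop atTop := by
  refine tendsto_atTop_mono' _ ?_ hρ
  have hlog := (tendsto_log_atTop.comp tendsto_natCast_atTop_atTop).eventually_ge_atTop 1
  filter_upwards [hlog] with n hn
  exact div_le_self (mul_nonneg n.cast_nonneg (hρ_pos n).le) hn

lemma tendsto_div_atTop_of_mul_rpow (hρ_pos : ∀ n, 0 < ρ n)
    (hρ : Tendsto (fun n : ℕ => n * ρ n) atTop atTop)
    (hB : Tendsto (fun n : ℕ => B n * (n : ℝ) ^ (-(3 / 2) : ℝ) * ρ n ^ (-(1 / 2) : ℝ))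
      atTop atTop) :
    Tendsto (fun n : ℕ => B n / n) atTop atTop := by
  refine tendsto_atTop_mono' _ ?_ hB
  filter_upwards [hB.eventually_ge_atTop 0, hρ.eventually_ge_atTop 1, eventually_gt_atTop 0]
    with n hBn hρn hn₀
  have hn : (0 : ℝ) < n := by exact_mod_cast hn₀
  have hfactor : B n * (n : ℝ) ^ (-(3 / 2) : ℝ) * ρ n ^ (-(1 / 2) : ℝ)
      = B n / n * (n * ρ n) ^ (-(1 / 2) : ℝ) := by
    rw [mul_rpow hn.le (hρ_pos n).le, ← mul_assoc, div_mul_eq_mul_div, mul_div_assoc,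
      ← rpow_sub_one hn.ne']
    norm_num
  rw [hfactor] at hBn ⊢
  exact mul_le_of_le_one_right (nonneg_of_mul_nonneg_left hBn (rpow_pos_of_pos (by linarith) _))
    (rpow_le_one_of_one_le_of_nonpos hρn (by norm_num))

lemma tendsto_exponent_atBot_of_tendsto_div (hB : Tendsto (fun n : ℕ => B n / n) atTop atTop)
    (C : ℝ) {δ : ℝ} (hδ : 0 < δ) :
    Tendsto (fun n : ℕ => C * n - (δ * B n - 1) / 2) atTop atBot := by
  have hfactor : Tendsto (fun n : ℕ => n * (C - δ / 2 * (B n / n)) + 1 / 2) atTop atBot :=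
    tendsto_atBot_add_const_right _ _ <| tendsto_natCast_atTop_atTop.atTop_mul_atBot₀ <|
      tendsto_const_nhds.add_atBot <| tendsto_neg_atTop_atBot.comp <|
        hB.const_mul_atTop (half_pos hδ)
  refine hfactor.congr' ?_
  filter_upwards [eventually_ne_atTop 0] with n hn
  field_simp
  ring

lemma tendsto_exponent_atBot_of_isLittleO (hρ : Tendsto (fun n : ℕ => n * ρ n) atTop atTop)
    (hB : B =o[atTop] fun n : ℕ => (n : ℝ) ^ 2 * ρ n) (C δ : ℝ) {a : ℝ} (ha : 0 < a) :
    Tendsto (fun n : ℕ => C * n - (δ * B n - 1) / 2 - a * (n ^ 2 * ρ n)) atTop atBot := by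
  have hslope : Tendsto (fun n : ℕ => a + δ / 2 * (B n / (n ^ 2 * ρ n))) atTop (𝓝 a) := by
    simpa using (hB.tendsto_div_nhds_zero.const_mul (δ / 2)).const_add a
  have hfactor : Tendsto
      (fun n : ℕ => n * (C - n * ρ n * (a + δ / 2 * (B n / (n ^ 2 * ρ n)))) + 1 / 2)
      atTop atBot :=
    tendsto_atBot_add_const_right _ _ <| tendsto_natCast_atTop_atTop.atTop_mul_atBot₀ <|
      tendsto_const_nhds.add_atBot <| tendsto_neg_atTop_atBot.comp <| hρ.atTop_mul_pos ha hslope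
  refine hfactor.congr' ?_
  filter_upwards [eventually_ne_atTop 0, hρ.eventually_gt_atTop 0] with n hn hnρ
  have hρn : ρ n ≠ 0 := right_ne_zero_of_mul hnρ.ne'
  field_simp
  ring

end Asymptotics

section Consistency

variable {K K' : ℕ} {θ : ℕ → Param K} {N B : ℕ → ℝ}

lemma measurableSet_criterion_lt (n : ℕ) (b : ℝ) (k k' : ℕ) :
    MeasurableSet {G : SimpleGraph (Fin n) | criterion N b G k < criterion N b G k'} :=
  (Set.toFinite _).measurableSet

lemma tendsto_sum_labelProb_compl_balancedLabels (hΘ : ∀ n, θ n ∈ Theta K) {r : ℝ} (hr₀ : 0 < r)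
    (hr : ∀ n a, r ≤ (θ n).prop a) :
    Tendsto (fun n : ℕ => ∑ Z ∈ (balancedLabels n K (r * n / 2))ᶜ, labelProb (θ n).prop Z)
      atTop (𝓝 0) := by
  have hrate : 0 < r * (1 / 2 - exp (-1)) := by
    have : (exp 1)⁻¹ < 2⁻¹ := inv_strictAnti₀ (by norm_num) (by linarith [exp_one_gt_d9])
    rw [exp_neg]
    exact mul_pos hr₀ (by linarith)
  have hlim : Tendsto (fun n : ℕ => K * exp (r * n / 2 - r * (1 - exp (-1)) * n)) atTop (𝓝 0) := by
    have h := (tendsto_exp_neg_atTop_nhds_zero.comp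
      (tendsto_natCast_atTop_atTop.const_mul_atTop hrate)).const_mul (K : ℝ)
    rw [mul_zero] at h
    refine h.congr fun n => ?_
    rw [Function.comp_apply]
    ring_nf
  exact squeeze_zero (fun n => sum_nonneg fun Z _ => (labelProb_pos (hΘ n).1 Z).le)
    (fun n => sum_labelProb_compl_balancedLabels_le (hΘ n).1 (hΘ n).2.1 (hr n) _) hlim

theorem tendsto_measureReal_criterion_lt_of_lt (hΘ : ∀ n, θ n ∈ Theta K) {r : ℝ} (hr₀ : 0 < r)
    (hr : ∀ n a, r ≤ (θ n).prop a) {ρ : ℕ → ℝ} (hρ : Tendsto (fun n : ℕ => n * ρ n) atTop atTop)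
    {Δ : ℝ} (hΔ₀ : 0 < Δ)
    (hΔ : ∀ n a b, a ≠ b → ∃ c, Δ * ρ n ≤ (√((θ n).conn c a) - √((θ n).conn c b)) ^ 2)
    (hB : B =o[atTop] fun n : ℕ => (n : ℝ) ^ 2 * ρ n) (hK' : 1 ≤ K') (hK : K' < K) :
    Tendsto (fun n => (law n (θ n)).real {G | criterion N (B n) G K' < criterion N (B n) G K})
      atTop (𝓝 1) := by
  have hprob (n : ℕ) := isProbabilityMeasure_law (n := n) (hΘ n)
  rw [tendsto_measureReal_one_iff_compl fun n => measurableSet_criterion_lt n _ _ _]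
  have : (0 : ℝ) < K' := by exact_mod_cast hK'
  set η := r / (2 * K')
  have hη : 0 < η := by positivity
  have hlim := (tendsto_sum_labelProb_compl_balancedLabels hΘ hr₀ hr).add <|
    tendsto_exp_atBot.comp <| tendsto_exponent_atBot_of_isLittleO hρ hB (unionRate K K')
      (N K' - N K) (show 0 < η ^ 2 * Δ / 16 by positivity)
  rw [add_zero] at hlim
  refine squeeze_zero' (.of_forall fun n => measureReal_nonneg) ?_ hlim
  filter_upwards [(tendsto_natCast_atTop_atTop.const_mul_atTop hη).eventually_ge_atTop 2] with n hn
  refine measureReal_compl_criterion_lt_le (hΘ n) hK' N (B n) _ fun Z hZ z θ' hθ' => ?_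
  have hbalanced (a : Fin K) : K' * (η * n) ≤ nodeCount Z a := by
    convert (mem_filter.1 hZ).2 a using 1
    simp only [η]
    field_simp
  convert le_sqrtDistSq_pairProb_of_lt hK' hK (hΘ n).2.2.1 (hΔ n) hθ'.2.2.1 hn hbalanced z using 1
  ring

theorem tendsto_measureReal_criterion_lt_of_gt (hΘ : ∀ n, θ n ∈ Theta K) (hK' : 1 ≤ K')
    (hN : N K < N K') (hB : Tendsto (fun n : ℕ => B n / n) atTop atTop) :
    Tendsto (fun n => (law n (θ n)).real {G | criterion N (B n) G K' < criterion N (B n) G K})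
      atTop (𝓝 1) := by
  have hprob (n : ℕ) := isProbabilityMeasure_law (n := n) (hΘ n)
  rw [tendsto_measureReal_one_iff_compl fun n => measurableSet_criterion_lt n _ _ _]
  refine squeeze_zero (fun n => measureReal_nonneg) (fun n => ?_) <| tendsto_exp_atBot.comp <|
    tendsto_exponent_atBot_of_tendsto_div hB (unionRate K K') (sub_pos.2 hN)
  simpa using measureReal_compl_criterion_lt_le (hΘ n) hK' N (B n) univ (α := 0)
    fun Z _ z θ' _ => by simpa using sqrtDistSq_nonneg _ _

lemma selected_eq_singleton_iff {n Kmax : ℕ} {b : ℝ} {G : SimpleGraph (Fin n)}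
    (hK : K ∈ Set.Icc 1 Kmax) : selected N b Kmax G = {K} ↔
      ∀ k ∈ (Icc 1 Kmax).erase K, criterion N b G k < criterion N b G K := by
  simp only [mem_erase, mem_Icc, and_imp]
  constructor
  · intro h k hne hk₁ hk₂
    have hmax : K ∈ selected N b Kmax G := h ▸ Set.mem_singleton K
    refine lt_of_not_ge fun hle => hne ?_
    have hk : k ∈ selected N b Kmax G := ⟨⟨hk₁, hk₂⟩, fun j hj => (hmax.2 hj).trans hle⟩
    rwa [h] at hk
  · refine fun h => Set.eq_singleton_iff_unique_mem.2 ⟨⟨hK, fun k hk => ?_⟩, fun k hk => ?_⟩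
    · rcases eq_or_ne k K with rfl | hne
      exacts [le_refl (criterion N b G k), (h k hne hk.1 hk.2).le]
    · by_contra hne
      exact (h k hne hk.1.1 hk.1.2).not_ge (hk.2 hK)

theorem tendsto_measureReal_selected_eq_singleton (hΘ : ∀ n, θ n ∈ Theta K) {Kmax : ℕ}
    (hK : K ≤ Kmax)
    (h : ∀ k, 1 ≤ k → k ≠ K → Tendsto (fun n =>
      (law n (θ n)).real {G | criterion N (B n) G k < criterion N (B n) G K}) atTop (𝓝 1)) :
    Tendsto (fun n => (law n (θ n)).real {G | selected N (B n) Kmax G = {K}}) atTop (𝓝 1) := by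
  have hprob (n : ℕ) := isProbabilityMeasure_law (n := n) (hΘ n)
  have hinter := tendsto_measureReal_biInter_one ((Icc 1 Kmax).erase K)
    (fun k n => measurableSet_criterion_lt n (B n) k K) fun k hk =>
      h k (mem_Icc.1 (mem_of_mem_erase hk)).1 (ne_of_mem_erase hk)
  simpa only [selected_eq_singleton_iff ⟨one_le_of_mem_Theta (hΘ 0), hK⟩, Set.ofPred_forall]
    using hinter

end Consistency

section Scaling

lemma exists_pos_forall_le {ι : Type*} [Finite ι] {f : ι → ℝ} (hf : ∀ i, 0 < f i) :
    ∃ r, 0 < r ∧ ∀ i, r ≤ f i := by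
  rcases isEmpty_or_nonempty ι with h | h
  · exact ⟨1, one_pos, fun i => h.elim i⟩
  · obtain ⟨i, hi⟩ := Finite.exists_min f
    exact ⟨f i, hf i, hi⟩

lemma exists_pos_forall_exists_mul_le_sq_sqrt_sub {ι κ : Type*} [Finite ι] {S : κ → ι → ℝ}
    (hS₀ : ∀ c a, 0 ≤ S c a) (hS : ∀ a b, a ≠ b → ∃ c, S c a ≠ S c b) :
    ∃ Δ, 0 < Δ ∧ ∀ ρ, 0 ≤ ρ → ∀ a b, a ≠ b →
      ∃ c, Δ * ρ ≤ (√(ρ * S c a) - √(ρ * S c b)) ^ 2 := by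
  choose c hc using hS
  obtain ⟨Δ, hΔ₀, hΔ⟩ := exists_pos_forall_le
    (f := fun e : {e : ι × ι // e.1 ≠ e.2} =>
      (√(S (c _ _ e.2) e.1.1) - √(S (c _ _ e.2) e.1.2)) ^ 2)
    fun e => sq_pos_of_ne_zero <| sub_ne_zero.2 fun h =>
      hc _ _ e.2 ((sqrt_inj (hS₀ _ _) (hS₀ _ _)).1 h)
  refine ⟨Δ, hΔ₀, fun ρ hρ a b hab => ⟨c a b hab, ?_⟩⟩
  rw [sqrt_mul hρ, sqrt_mul hρ, ← mul_sub, mul_pow, sq_sqrt hρ, mul_comm]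
  exact mul_le_mul_of_nonneg_left (hΔ ⟨(a, b), hab⟩) hρ

end Scaling

end SBM

theorem corollary1_general (K : ℕ) (θ : ℕ → SBM.Param K) (hΘ : ∀ n, θ n ∈ SBM.Theta K)
    {r : ℝ} (hr₀ : 0 < r) (hr : ∀ n a, r ≤ (θ n).prop a)
    {ρ : ℕ → ℝ} (hρ : Tendsto (fun n : ℕ => n * ρ n) atTop atTop)
    {Δ : ℝ} (hΔ₀ : 0 < Δ)
    (hΔ : ∀ n a b, a ≠ b → ∃ c, Δ * ρ n ≤ (√((θ n).conn c a) - √((θ n).conn c b)) ^ 2)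
    (N : ℕ → ℝ) (hN : ∀ k, K < k → N K < N k) (B : ℕ → ℝ) :
    (B =o[atTop] (fun n : ℕ => (n : ℝ) ^ 2 * ρ n) →
      ∀ K' : ℕ, 1 ≤ K' → K' < K →
        Tendsto (fun n : ℕ => (SBM.law n (θ n)).real
          {G | SBM.criterion N (B n) G K' < SBM.criterion N (B n) G K}) atTop (𝓝 1)) ∧
    (Tendsto (fun n : ℕ => B n / n) atTop atTop →
      ∀ K' : ℕ, K < K' →
        Tendsto (fun n : ℕ => (SBM.law n (θ n)).real
          {G | SBM.criterion N (B n) G K' < SBM.criterion N (B n) G K}) atTop (𝓝 1)) ∧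
    (B =o[atTop] (fun n : ℕ => (n : ℝ) ^ 2 * ρ n) →
      Tendsto (fun n : ℕ => B n / n) atTop atTop →
      ∀ Kmax : ℕ, K ≤ Kmax →
        Tendsto (fun n : ℕ => (SBM.law n (θ n)).real
          {G | SBM.selected N (B n) Kmax G = {K}}) atTop (𝓝 1)) := by
  have hunder (hB : B =o[atTop] fun n : ℕ => (n : ℝ) ^ 2 * ρ n) (k : ℕ) (hk : 1 ≤ k)
      (hkK : k < K) :=
    SBM.tendsto_measureReal_criterion_lt_of_lt (N := N) hΘ hr₀ hr hρ hΔ₀ hΔ hB hk hkK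
  have hover (hB : Tendsto (fun n : ℕ => B n / n) atTop atTop) (k : ℕ) (hkK : K < k) :=
    SBM.tendsto_measureReal_criterion_lt_of_gt hΘ (Nat.one_le_of_lt hkK) (hN k hkK) hB
  refine ⟨hunder, hover, fun hB hB' Kmax hK => ?_⟩
  exact SBM.tendsto_measureReal_selected_eq_singleton hΘ hK fun k hk hne =>
    hne.lt_or_gt.elim (hunder hB k hk) (hover hB' k)

theorem corollary1 (K : ℕ) (p : Fin K → ℝ) (S : Matrix (Fin K) (Fin K) ℝ) (ρ : ℕ → ℝ)
    (hρ_pos : ∀ n, 0 < ρ n)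
    (hρ : Tendsto (fun n : ℕ => (n : ℝ) * ρ n / Real.log n) atTop atTop)
    (hΘ : ∀ n, (⟨p, ρ n • S⟩ : SBM.Param K) ∈ SBM.Theta K)
    (hS : ∀ a b : Fin K, a ≠ b → ∃ c, S c a ≠ S c b)
    (N : ℕ → ℝ) (hN : StrictMonoOn N (Set.Ici 1)) (B : ℕ → ℝ) :
    (B =o[atTop] (fun n : ℕ => (n : ℝ) ^ 2 * ρ n) →
      ∀ K' : ℕ, 1 ≤ K' → K' < K →
        Tendsto (fun n : ℕ => (SBM.law n (⟨p, ρ n • S⟩ : SBM.Param K)).real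
          {G | SBM.criterion N (B n) G K' < SBM.criterion N (B n) G K}) atTop (𝓝 1)) ∧
    (Tendsto (fun n : ℕ => B n * (n : ℝ) ^ (-(3 / 2) : ℝ) * ρ n ^ (-(1 / 2) : ℝ)) atTop atTop →
      ∀ K' : ℕ, K < K' →
        Tendsto (fun n : ℕ => (SBM.law n (⟨p, ρ n • S⟩ : SBM.Param K)).real
          {G | SBM.criterion N (B n) G K' < SBM.criterion N (B n) G K}) atTop (𝓝 1)) ∧
    (B =o[atTop] (fun n : ℕ => (n : ℝ) ^ 2 * ρ n) →
      Tendsto (fun n : ℕ => B n * (n : ℝ) ^ (-(3 / 2) : ℝ) * ρ n ^ (-(1 / 2) : ℝ)) atTop atTop →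
      ∀ Kmax : ℕ, K ≤ Kmax →
        Tendsto (fun n : ℕ => (SBM.law n (⟨p, ρ n • S⟩ : SBM.Param K)).real
          {G | SBM.selected N (B n) Kmax G = {K}}) atTop (𝓝 1)) := by
  have hS₀ (a b : Fin K) : 0 ≤ S a b :=
    (pos_of_mul_pos_right ((hΘ 0).2.2.2 a b).1 (hρ_pos 0).le).le
  obtain ⟨r, hr₀, hr⟩ := SBM.exists_pos_forall_le (hΘ 0).1
  obtain ⟨Δ, hΔ₀, hΔ⟩ := SBM.exists_pos_forall_exists_mul_le_sq_sqrt_sub hS₀ hS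
  have hρ' := SBM.tendsto_mul_atTop_of_div_log hρ_pos hρ
  have hB' := SBM.tendsto_div_atTop_of_mul_rpow (B := B) hρ_pos hρ'
  obtain ⟨hunder, hover, hselected⟩ := corollary1_general K _ hΘ hr₀ (fun _ => hr) hρ' hΔ₀
    (fun n => hΔ (ρ n) (hρ_pos n).le) N
    (fun k hk => hN (SBM.one_le_of_mem_Theta (hΘ 0)) (Nat.one_le_of_lt hk) hk) B
  exact ⟨hunder, hover ∘ hB', fun hBo => hselected hBo ∘ hB'⟩
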